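/- Let $\zeta\colon[0,\infty)\to\mathbb R$ be real analytic (up to and including $0$) with $-1<\zeta(x)<0$ for all $x>0$, and let $c_0\in(-1,0)$. For $L>0$ and $\tilde z\in\mathbb R$ let $\tilde v(\cdot\,;L,\tilde z)$ denote the solution of the initial value problem $$-\tilde v_{yy}+L^2\big(\tilde v^3-\tilde v+\zeta(Ly)\big)=0\ \text{ for } y\in(0,1),\qquad \tilde v(0)=c_0,\quad \tilde v_y(0)=\tilde z,$$ and, whenever this solution exists on all of $[0,1]$, put $f(L,\tilde z):=\tilde v_y(1;L,\tilde z)$. Let $$E:=\{L>0:\ \text{there is } \tilde z\in\mathbb R \text{ with } f(L,\tilde z)=0 \text{ and } \partial_{\tilde z}f(L,\tilde z)=0\}.$$ **Theorem.** Let $L\in(0,\infty)\setminus E$. Then the stationary problem $$\begin{cases}0=\mu_{xx}\ \text{ in }(0,L),\qquad \mu:=-u_{xx}+(u+c_0)^3-(u+c_0)+\zeta,\\ u(0)=u_x(L)=0,\\ \mu(0)=\mu_x(L)=0,\end{cases}$$ has only finitely many solutions $u\in C^4([0,L])$, and at least one. Writing $u^1,\dots,u^{N(L)}$ ($N(L)\ge1$)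 for all of them, the linearized operator at each $u^i$ has trivial kernel: if $h\in H^2(0,L)$ satisfies $$-h_{xx}+\big(3(u^i(x)+c_0)^2-1\big)h=0\ \text{ a.e. in }(0,L),\qquad h(0)=0,\quad h_x(L)=0,$$ then $h=0$. -/

import Mathlib

/-- The chemical potential `μ = -u_xx + (u + c₀)³ - (u + c₀) + ζ` on `[0, L]`; at the endpoints
the derivatives are one-sided. -/
noncomputable def chemPotential (ζ : ℝ → ℝ) (c₀ L : ℝ) (u : ℝ → ℝ) (x : ℝ) : ℝ :=
  -(iteratedDerivWithin 2 u (Set.Icc 0 L) x) + (u x + c₀) ^ 3 - (u x + c₀) + ζ x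

/-- `u` is a (classical) solution on `[0, L]` of the stationary problem
`0 = (-u_xx + (u + c₀)³ - (u + c₀) + ζ)_xx` in `(0, L)`,
`u(0) = u_x(L) = 0`, `μ(0) = μ_x(L) = 0`. Only the values of `u` on `[0, L]` matter. -/
structure IsSteadyState (ζ : ℝ → ℝ) (c₀ L : ℝ) (u : ℝ → ℝ) : Prop where
  contDiffOn : ContDiffOn ℝ 4 u (Set.Icc 0 L)
  equation : ∀ x ∈ Set.Ioo 0 L,
    iteratedDerivWithin 2 (chemPotential ζ c₀ L u) (Set.Icc 0 L) x = 0
  dirichlet_left : u 0 = 0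
  neumann_right : derivWithin u (Set.Icc 0 L) L = 0
  potential_left : chemPotential ζ c₀ L u 0 = 0
  potential_right : derivWithin (chemPotential ζ c₀ L u) (Set.Icc 0 L) L = 0

/-- `v` solves on `[0, 1]` the rescaled initial value problem
`-v_yy + L² (v³ - v + ζ(L y)) = 0`, `v(0) = c₀`, `v_y(0) = z`. -/
structure IsShootingSolution (ζ : ℝ → ℝ) (c₀ L z : ℝ) (v : ℝ → ℝ) : Prop where
  contDiffOn : ContDiffOn ℝ 2 v (Set.Icc 0 1)
  equation : ∀ y ∈ Set.Ioo (0 : ℝ) 1,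
    -(iteratedDerivWithin 2 v (Set.Icc 0 1) y) + L ^ 2 * (v y ^ 3 - v y + ζ (L * y)) = 0
  initial_value : v 0 = c₀
  initial_slope : derivWithin v (Set.Icc 0 1) 0 = z

open Classical in
/-- The shooting function `f(L, z) = v_y(1; L, z)`, where `v(·; L, z)` is the (unique) solution of
the rescaled initial value problem. For some `(L, z)` that solution blows up before `y = 1`;
the value is then irrelevant and set to `0`. -/
noncomputable def shootingMap (ζ : ℝ → ℝ) (c₀ L z : ℝ) : ℝ :=
  if h : ∃ v, IsShootingSolution ζ c₀ L z v then derivWithin h.choose (Set.Icc 0 1) 1 else 0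

/-- `z` is a zero of `f(L, ·)`, the solution `v(·; L, z)` existing on the whole of `[0, 1]`. -/
def IsShootingZero (ζ : ℝ → ℝ) (c₀ L z : ℝ) : Prop :=
  (∃ v, IsShootingSolution ζ c₀ L z v) ∧ shootingMap ζ c₀ L z = 0

/-- `(L, z)` is a branch point: `f(L, z) = 0` and `∂_z f(L, z) = 0`. -/
def IsBranchPoint (ζ : ℝ → ℝ) (c₀ L z : ℝ) : Prop :=
  IsShootingZero ζ c₀ L z ∧ HasDerivAt (fun w => shootingMap ζ c₀ L w) 0 z

/-- The set `E` of exceptional lengths: those `L > 0` for which some zero of `f(L, ·)` is a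
branch point. -/
def exceptionalLengths (ζ : ℝ → ℝ) (c₀ : ℝ) : Set ℝ :=
  {L | 0 < L ∧ ∃ z, IsBranchPoint ζ c₀ L z}

/-- `h` lies in `H²(0, L)` with weak derivatives `h_x = h₁` and `h_xx = h₂`, represented by the
function that is continuously differentiable on `[0, L]`. -/
structure IsH2With (L : ℝ) (h h₁ h₂ : ℝ → ℝ) : Prop where
  memLp : MeasureTheory.MemLp h₂ 2 (MeasureTheory.volume.restrict (Set.Ioo 0 L))
  deriv_eq : ∀ x ∈ Set.Icc 0 L, h₁ x = h₁ 0 + ∫ s in (0 : ℝ)..x, h₂ s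
  eq : ∀ x ∈ Set.Icc 0 L, h x = h 0 + ∫ s in (0 : ℝ)..x, h₁ s

/-- `h` lies in the kernel of the linearized operator at `u`, which is
`h ↦ -h_xx + (3 (u + c₀)² - 1) h` with domain `{h ∈ H²(0, L) : h(0) = 0 = h_x(L)}`. -/
def InLinearizedKernel (c₀ L : ℝ) (u h : ℝ → ℝ) : Prop :=
  ∃ h₁ h₂ : ℝ → ℝ, IsH2With L h h₁ h₂ ∧ h 0 = 0 ∧ h₁ L = 0 ∧
    ∀ᵐ x ∂(MeasureTheory.volume.restrict (Set.Ioo 0 L)),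
      -(h₂ x) + (3 * (u x + c₀) ^ 2 - 1) * h x = 0

/-! The two conditions on `μ` force `μ = 0`, so after rescaling, steady states are the solutions of
`v'' = L² (v³ - v + ζ(L y))` with `v(0) = c₀`, `v'(1) = 0`, and they are parametrized by the initial
slope `z`.

Since trajectories may blow up, the cubic is evaluated at `v` clamped to `[-3, 3]`. The resulting
flow `P`, `Q` is global, with terminal slope `Q z 1` continuous in `z` and within `31 L²` of `z`. So
the zero set `Z` of `Q · 1` is nonempty (intermediate values) and compact. Clamping loses nothing:
by the maximum principle `le_of_convex`, solutions of either boundary value problem stay in `[-2,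
2]`, and the gap up to `3` keeps nearby trajectories unclamped. Hence `Z` enumerates the steady
states, and near `Z` the terminal slope is `shootingMap`.

By `hasDerivAt_flow`, the derivative of the terminal slope at `z ∈ Z` is `K 1`, where `H`, `K = H'`
solve the linearized equation with `H 0 = 0`, `K 0 = 1`. As `L` is not exceptional, `K 1 ≠ 0`. Thus
zeros are isolated, and a compact set of isolated points is finite. A kernel element is a multiple
of `H` after rescaling, and its Neumann condition makes the multiple vanish. -/

open Set Filter Topology

/-! ### Second order equations as derivative pairs: Gronwall and maximum principle -/

/-- On `[0, b]` the function `p` has derivative `q`, and `q` has derivative `s`. -/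
def HasDerivPair (b : ℝ) (p q s : ℝ → ℝ) : Prop :=
  ∀ y ∈ Icc 0 b, HasDerivWithinAt p (q y) (Icc 0 b) y ∧ HasDerivWithinAt q (s y) (Icc 0 b) y

namespace HasDerivPair

variable {b : ℝ} {p q s p' q' s' : ℝ → ℝ}

theorem continuousOn_left (h : HasDerivPair b p q s) : ContinuousOn p (Icc 0 b) :=
  fun y hy => (h y hy).1.continuousWithinAt

theorem continuousOn_right (h : HasDerivPair b p q s) : ContinuousOn q (Icc 0 b) :=
  fun y hy => (h y hy).2.continuousWithinAt

theorem congr_right (h : HasDerivPair b p q s) (hs : EqOn s s' (Icc 0 b)) :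
    HasDerivPair b p q s' :=
  fun y hy => ⟨(h y hy).1, hs hy ▸ (h y hy).2⟩

theorem sub (h : HasDerivPair b p q s) (h' : HasDerivPair b p' q' s') :
    HasDerivPair b (fun y => p y - p' y) (fun y => q y - q' y) (fun y => s y - s' y) :=
  fun y hy => ⟨(h y hy).1.sub (h' y hy).1, (h y hy).2.sub (h' y hy).2⟩

theorem const_mul (c : ℝ) (h : HasDerivPair b p q s) :
    HasDerivPair b (fun y => c * p y) (fun y => c * q y) (fun y => c * s y) :=
  fun y hy => ⟨(h y hy).1.const_mul c, (h y hy).2.const_mul c⟩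

theorem neg (h : HasDerivPair b p q s) :
    HasDerivPair b (fun y => -p y) (fun y => -q y) (fun y => -s y) :=
  fun y hy => ⟨(h y hy).1.neg, (h y hy).2.neg⟩

theorem sub_const (c : ℝ) (h : HasDerivPair b p q s) :
    HasDerivPair b (fun y => p y - c) q s :=
  fun y hy => ⟨(h y hy).1.sub_const c, (h y hy).2⟩

theorem add_const (c : ℝ) (h : HasDerivPair b p q s) :
    HasDerivPair b (fun y => p y + c) q s :=
  fun y hy => ⟨(h y hy).1.add_const c, (h y hy).2⟩

/-- Rescaling of the independent variable. -/
theorem comp_mul {c d : ℝ} (hc : 0 < c) (hd : c * d = b) (h : HasDerivPair b p q s) :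
    HasDerivPair d (fun y => p (c * y)) (fun y => c * q (c * y))
      (fun y => c ^ 2 * s (c * y)) := by
  intro y hy
  have hmaps : MapsTo (fun y => c * y) (Icc 0 d) (Icc 0 b) := fun y hy =>
    ⟨mul_nonneg hc.le hy.1, hd ▸ mul_le_mul_of_nonneg_left hy.2 hc.le⟩
  have hlin : HasDerivWithinAt (fun y => c * y) c (Icc 0 d) y := by
    simpa using (hasDerivWithinAt_id y (Icc 0 d)).const_mul c
  obtain ⟨h₁, h₂⟩ := h _ (hmaps hy)
  refine ⟨?_, ?_⟩
  · simpa [mul_comm, Function.comp_def] using h₁.comp y hlin hmaps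
  · have := (h₂.comp y hlin hmaps).const_mul c
    exact this.congr_deriv (by ring)

/-- Gronwall's inequality for second order equations. -/
theorem abs_le_exp {K ε δ : ℝ} (hK : 1 ≤ K) (hε : 0 ≤ ε) (h : HasDerivPair b p q s)
    (hs : ∀ y ∈ Icc 0 b, |s y| ≤ K * |p y| + ε) (hp : |p 0| ≤ δ) (hq : |q 0| ≤ δ) :
    ∀ y ∈ Icc 0 b, |p y| ≤ (δ + ε) * Real.exp (K * b) ∧ |q y| ≤ (δ + ε) * Real.exp (K * b) := by
  intro y hy
  have hK0 : 0 < K := by linarith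
  have hδ : 0 ≤ δ := (abs_nonneg _).trans hp
  -- In the sup norm on pairs, `1 ≤ K` lets the same constant also bound the first component `q` of
  -- the field.
  have key := norm_le_gronwallBound_of_norm_deriv_right_le (f := fun y => (p y, q y))
    (f' := fun y => (q y, s y)) (δ := δ) (K := K) (ε := ε) (a := 0) (b := b)
    (h.continuousOn_left.prodMk h.continuousOn_right)
    (fun x hx => by
      have hx' : x ∈ Icc 0 b := ⟨hx.1, hx.2.le⟩
      have := (h x hx').1.prodMk (h x hx').2
      refine this.mono_of_mem_nhdsWithin ?_
      exact mem_of_superset (Icc_mem_nhdsGE hx.2) (Icc_subset_Icc_left hx.1))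
    (by simp [Prod.norm_def, hp, hq])
    (fun x hx => by
      have hx' : x ∈ Icc 0 b := ⟨hx.1, hx.2.le⟩
      simp only [Prod.norm_def, Real.norm_eq_abs]
      have h1 : |p x| ≤ max |p x| |q x| := le_max_left _ _
      have h2 : |q x| ≤ max |p x| |q x| := le_max_right _ _
      have h3 := hs x hx'
      have h4 := abs_nonneg (q x)
      refine max_le ?_ ?_ <;> nlinarith) y hy
  have hle : gronwallBound δ K ε (y - 0) ≤ (δ + ε) * Real.exp (K * b) := by
    rw [gronwallBound_of_K_ne_0 hK0.ne', sub_zero]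
    have h1 : Real.exp (K * y) ≤ Real.exp (K * b) :=
      Real.exp_le_exp.2 (mul_le_mul_of_nonneg_left hy.2 hK0.le)
    have h2 : ε / K ≤ ε := div_le_self hε hK
    have h3 : 1 ≤ Real.exp (K * y) := Real.one_le_exp (mul_nonneg hK0.le hy.1)
    have h4 : ε / K * (Real.exp (K * y) - 1) ≤ ε * Real.exp (K * b) :=
      mul_le_mul h2 (by linarith) (by linarith) hε
    have h5 : δ * Real.exp (K * y) ≤ δ * Real.exp (K * b) := mul_le_mul_of_nonneg_left h1 hδ
    dsimp only
    linarith
  have := key.trans hle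
  simp only [Prod.norm_def, Real.norm_eq_abs] at this
  exact ⟨(le_max_left _ _).trans this, (le_max_right _ _).trans this⟩

/-- Uniqueness for linear second order inequalities with vanishing initial data. -/
theorem eq_zero {K : ℝ} (h : HasDerivPair b p q s)
    (hs : ∀ y ∈ Icc 0 b, |s y| ≤ K * |p y|) (hp : p 0 = 0) (hq : q 0 = 0) :
    ∀ y ∈ Icc 0 b, p y = 0 ∧ q y = 0 := by
  intro y hy
  have := h.abs_le_exp (K := max K 1) (ε := 0) (δ := 0) (le_max_right _ _) le_rfl
    (fun y hy => by
      have := mul_le_mul_of_nonneg_right (le_max_left K 1) (abs_nonneg (p y))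
      linarith [hs y hy]) (by simp [hp]) (by simp [hq]) y hy
  simpa using this

/-- A maximum principle: `p` stays below `M` if it is convex wherever it exceeds `M`. -/
theorem le_of_convex {M : ℝ} (h : HasDerivPair b p q s) (hb : 0 ≤ b) (h0 : p 0 < M)
    (hq : q b = 0) (hs : ∀ y ∈ Ioc 0 b, M < p y → 0 < s y) : ∀ y ∈ Icc 0 b, p y ≤ M := by
  obtain ⟨x, hx, hmax⟩ := isCompact_Icc.exists_isMaxOn (nonempty_Icc.2 hb) h.continuousOn_left
  intro y hy
  refine (hmax hy).trans ?_
  by_contra! hM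
  have hx0 : 0 < x := lt_of_le_of_ne hx.1 (fun e => by rw [← e] at hM; exact absurd hM h0.not_gt)
  -- An interior maximum is critical; at the right endpoint the Neumann condition gives the same.
  have hqx : q x = 0 := by
    rcases hx.2.lt_or_eq with hlt | heq
    · have hnhds : Icc 0 b ∈ 𝓝 x := Icc_mem_nhds hx0 hlt
      exact (hmax.isLocalMax hnhds).hasDerivAt_eq_zero ((h x hx).1.hasDerivAt hnhds)
    · rw [heq, hq]
  have hev : ∀ᶠ y in 𝓝[Icc 0 b] x, M < p y :=
    (h.continuousOn_left x hx).eventually (lt_mem_nhds hM)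
  obtain ⟨δ, hδ, hball⟩ := Metric.mem_nhdsWithin_iff.1 hev
  -- On `[a, x]` the function exceeds `M`, so `q` increases strictly to `q x = 0`. Then `p`
  -- decreases strictly there, against maximality at `x`.
  set a := max (x - δ / 2) (x / 2) with ha
  have hax : a < x := max_lt (by linarith) (by linarith)
  have ha0 : 0 < a := lt_of_lt_of_le (by linarith) (le_max_right _ _)
  have haδ : x - δ / 2 ≤ a := le_max_left _ _
  have hsub : Icc a x ⊆ Icc 0 b := Icc_subset_Icc ha0.le hx.2
  have hgt : ∀ y ∈ Icc a x, M < p y := fun y hy => hball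
    ⟨by rw [Metric.mem_ball, Real.dist_eq, abs_lt]; constructor <;> linarith [hy.1, hy.2], hsub hy⟩
  have hder : ∀ y ∈ Ioo a x, HasDerivAt p (q y) y ∧ HasDerivAt q (s y) y := fun y hy => by
    have hn : Icc 0 b ∈ 𝓝 y := Icc_mem_nhds (ha0.trans hy.1) (hy.2.trans_le hx.2)
    have := h y (hsub ⟨hy.1.le, hy.2.le⟩)
    exact ⟨this.1.hasDerivAt hn, this.2.hasDerivAt hn⟩
  have hqmono : StrictMonoOn q (Icc a x) := by
    refine strictMonoOn_of_deriv_pos (convex_Icc a x) (h.continuousOn_right.mono hsub) ?_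
    rw [interior_Icc]
    intro y hy
    rw [(hder y hy).2.deriv]
    exact hs y ⟨ha0.trans hy.1, hy.2.le.trans hx.2⟩ (hgt y ⟨hy.1.le, hy.2.le⟩)
  have hpanti : StrictAntiOn p (Icc a x) := by
    refine strictAntiOn_of_deriv_neg (convex_Icc a x) (h.continuousOn_left.mono hsub) ?_
    rw [interior_Icc]
    intro y hy
    rw [(hder y hy).1.deriv, ← hqx]
    exact hqmono ⟨hy.1.le, hy.2.le⟩ ⟨hax.le, le_rfl⟩ hy.2
  exact absurd (hmax (hsub ⟨le_rfl, hax.le⟩))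
    (hpanti ⟨le_rfl, hax.le⟩ ⟨hax.le, le_rfl⟩ hax).not_ge

end HasDerivPair

/-! ### Global existence for bounded and for linear fields -/

/-- Global existence for `p'' = G(y, p)` on `[0, 1]` when `G` is bounded and Lipschitz in `p`. -/
theorem exists_hasDerivPair {G : ℝ → ℝ → ℝ} {C K : NNReal}
    (hlip : ∀ y ∈ Icc (0 : ℝ) 1, LipschitzWith K (G y))
    (hcont : ∀ x, ContinuousOn (fun y => G y x) (Icc 0 1))
    (hbdd : ∀ y ∈ Icc (0 : ℝ) 1, ∀ x, |G y x| ≤ C) (p₀ q₀ : ℝ) :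
    ∃ p q : ℝ → ℝ, p 0 = p₀ ∧ q 0 = q₀ ∧ HasDerivPair 1 p q (fun y => G y (p y)) := by
  -- The second component is doubled so that the field is at most `a` on a ball of radius `a`.
  set a : NNReal := 2 * ‖q₀‖₊ + 2 * C with ha
  have haR : (a : ℝ) = 2 * |q₀| + 2 * C := by simp [ha]
  have hPL : IsPicardLindelof (fun y (x : ℝ × ℝ) => (x.2 / 2, 2 * G y x.1))
      (⟨0, by simp⟩ : Icc (0 : ℝ) 1) (p₀, 2 * q₀) a 0 a (max 1 (2 * K)) := by
    refine ⟨fun y hy => ?_, fun x _ => ?_, fun y hy x hx => ?_, ?_⟩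
    · refine LipschitzOnWith.of_dist_le_mul fun x _ x' _ => ?_
      have h1 : |x.2 - x'.2| ≤ dist x x' := by
        rw [← Real.dist_eq]; exact le_max_right _ _
      have h2 : |G y x.1 - G y x'.1| ≤ K * dist x x' := by
        rw [← Real.dist_eq]
        exact ((hlip y hy).dist_le_mul _ _).trans
          (mul_le_mul_of_nonneg_left (le_max_left _ _) K.2)
      have hd : 0 ≤ dist x x' := dist_nonneg
      rw [Prod.dist_eq, Real.dist_eq, Real.dist_eq, ← sub_div, ← mul_sub, abs_div, abs_mul]
      simp only [Nat.abs_ofNat, NNReal.coe_max, NNReal.coe_one, NNReal.coe_mul, NNReal.coe_ofNat]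
      have h3 : (1 : ℝ) ≤ max 1 (2 * (K : ℝ)) := le_max_left _ _
      have h4 : 2 * (K : ℝ) ≤ max 1 (2 * (K : ℝ)) := le_max_right _ _
      refine max_le ?_ ?_ <;> nlinarith
    · exact continuousOn_const.prodMk ((hcont x.1).const_smul (2 : ℝ))
    · rw [mem_closedBall_iff_norm] at hx
      have h1 : |x.2 - 2 * q₀| ≤ a := (le_max_right _ _).trans hx
      have h2 := hbdd y hy x.1
      rw [Prod.norm_def, Real.norm_eq_abs, Real.norm_eq_abs, abs_div, abs_mul]
      simp only [Nat.abs_ofNat]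
      have h3 : |x.2| ≤ |x.2 - 2 * q₀| + |2 * q₀| := by
        simpa using abs_add_le (x.2 - 2 * q₀) (2 * q₀)
      rw [abs_mul, Nat.abs_ofNat] at h3
      have := abs_nonneg q₀
      have := C.2
      refine max_le ?_ ?_ <;> rw [haR] at * <;> linarith
    · simp
  obtain ⟨α, hα0, hα⟩ := hPL.exists_eq_forall_mem_Icc_hasDerivWithinAt₀
  refine ⟨fun y => (α y).1, fun y => (α y).2 / 2, ?_, ?_, fun y hy => ⟨?_, ?_⟩⟩
  · simpa using congrArg Prod.fst hα0
  · have := congrArg Prod.snd hα0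
    simp only at this
    simp [this]
  · exact (hα y hy).fst
  · have h2 : HasDerivWithinAt (fun y => (α y).2) (2 * G y (α y).1) (Icc 0 1) y :=
      (hα y hy).snd
    simpa using h2.div_const 2

/-- Clamping to `[-R, R]`. -/
noncomputable def clamp (R x : ℝ) : ℝ := max (-R) (min x R)

theorem clamp_of_abs_le {R x : ℝ} (h : |x| ≤ R) : clamp R x = x := by
  rw [abs_le] at h
  rw [clamp, min_eq_left h.2, max_eq_right h.1]

theorem abs_clamp_le {R : ℝ} (hR : 0 ≤ R) (x : ℝ) : |clamp R x| ≤ R :=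
  abs_le.2 ⟨le_max_left _ _, max_le (by linarith) (min_le_right _ _)⟩

theorem abs_clamp_sub_le (R x y : ℝ) : |clamp R x - clamp R y| ≤ |x - y| :=
  (abs_max_sub_max_le_max _ _ _ _).trans
    (by simpa using (abs_min_sub_min_le_max x R y R))

theorem abs_clamp_le_abs {R : ℝ} (hR : 0 ≤ R) (x : ℝ) : |clamp R x| ≤ |x| := by
  simpa [clamp_of_abs_le (R := R) (x := 0) (by simpa using hR)] using abs_clamp_sub_le R x 0

/-- Global existence for the linear equation `p'' = a(y) p` on `[0, 1]`. -/
theorem exists_hasDerivPair_linear {a : ℝ → ℝ} (ha : ContinuousOn a (Icc 0 1)) :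
    ∃ p q : ℝ → ℝ, p 0 = 0 ∧ q 0 = 1 ∧ HasDerivPair 1 p q (fun y => a y * p y) := by
  obtain ⟨A₀, hA₀⟩ := isCompact_Icc.exists_bound_of_continuousOn ha
  set A : NNReal := max 1 A₀.toNNReal with hA
  have hA1 : (1 : ℝ) ≤ A := by simp [hA]
  have hAa : ∀ y ∈ Icc (0 : ℝ) 1, |a y| ≤ A := fun y hy => by
    refine (hA₀ y hy).trans ((Real.le_coe_toNNReal _).trans ?_)
    exact NNReal.coe_le_coe.2 (le_max_right _ _)
  -- The Gronwall bound for initial data `(0, 1)`, valid also for the clamped equation; hence the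
  -- clamp is never active.
  set R : NNReal := ⟨Real.exp (A * 1), (Real.exp_pos _).le⟩ with hR
  have hcl : ∀ y ∈ Icc (0 : ℝ) 1, ∀ x, |a y * clamp R x| ≤ A * |x| := fun y hy x => by
    rw [abs_mul]
    exact mul_le_mul (hAa y hy) (abs_clamp_le_abs R.2 x) (abs_nonneg _) A.2
  obtain ⟨p, q, hp, hq, h⟩ := exists_hasDerivPair (G := fun y x => a y * clamp R x)
    (C := A * R) (K := A)
    (fun y hy => LipschitzWith.of_dist_le_mul fun x x' => by
      rw [Real.dist_eq, ← mul_sub, abs_mul, Real.dist_eq]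
      exact mul_le_mul (hAa y hy) (abs_clamp_sub_le _ _ _) (abs_nonneg _) A.2)
    (fun x => ha.mul continuousOn_const)
    (fun y hy x => by
      rw [abs_mul, NNReal.coe_mul]
      exact mul_le_mul (hAa y hy) (abs_clamp_le R.2 _) (abs_nonneg _) A.2) 0 1
  refine ⟨p, q, hp, hq, h.congr_right fun y hy => ?_⟩
  have := (h.abs_le_exp hA1 le_rfl (δ := 1) (fun y hy => by simpa using hcl y hy (p y))
    (by simp [hp]) (by simp [hq]) y hy).1
  simp only [add_zero, one_mul] at this
  exact congrArg (a y * ·) (clamp_of_abs_le this)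

/-! ### Regularity up to the endpoints -/

theorem ContDiffOn.hasDerivPair {b : ℝ} (hb : 0 < b) {p : ℝ → ℝ} (h : ContDiffOn ℝ 2 p (Icc 0 b)) :
    HasDerivPair b p (derivWithin p (Icc 0 b)) (iteratedDerivWithin 2 p (Icc 0 b)) := by
  have hu := uniqueDiffOn_Icc hb
  have h1 : ContDiffOn ℝ 1 (derivWithin p (Icc 0 b)) (Icc 0 b) :=
    h.derivWithin hu (by norm_num)
  intro y hy
  refine ⟨((h.differentiableOn (by norm_num)) y hy).hasDerivWithinAt, ?_⟩
  have := ((h1.differentiableOn (by norm_num)) y hy).hasDerivWithinAt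
  rw [iteratedDerivWithin_succ, iteratedDerivWithin_one]
  exact this

/-- Both sides are continuous on the closed interval, so an equation known inside extends to the
endpoints. -/
theorem ContDiffOn.hasDerivPair_of_eqOn_Ioo {b : ℝ} (hb : 0 < b) {p g : ℝ → ℝ}
    (h : ContDiffOn ℝ 2 p (Icc 0 b)) (hg : ContinuousOn g (Icc 0 b))
    (heq : EqOn (iteratedDerivWithin 2 p (Icc 0 b)) g (Ioo 0 b)) :
    HasDerivPair b p (derivWithin p (Icc 0 b)) g := by
  refine (h.hasDerivPair hb).congr_right ?_
  refine heq.of_subset_closure ?_ hg Ioo_subset_Icc_self (by rw [closure_Ioo hb.ne])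
  exact h.continuousOn_iteratedDerivWithin le_rfl (uniqueDiffOn_Icc hb)

theorem contDiffOn_succ_of_hasDerivWithinAt {b : ℝ} (hb : 0 < b) {p q : ℝ → ℝ} {n : ℕ}
    (h : ∀ y ∈ Icc 0 b, HasDerivWithinAt p (q y) (Icc 0 b) y) (hq : ContDiffOn ℝ n q (Icc 0 b)) :
    ContDiffOn ℝ (n + 1) p (Icc 0 b) := by
  rw [contDiffOn_succ_iff_derivWithin (uniqueDiffOn_Icc hb)]
  refine ⟨fun y hy => (h y hy).differentiableWithinAt, fun e => by simp at e, ?_⟩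
  exact hq.congr fun y hy => (h y hy).derivWithin (uniqueDiffOn_Icc hb y hy)

namespace HasDerivPair

variable {b : ℝ} {p q s : ℝ → ℝ}

theorem derivWithin_eqOn (hb : 0 < b) (h : HasDerivPair b p q s) :
    EqOn (derivWithin p (Icc 0 b)) q (Icc 0 b) :=
  fun y hy => (h y hy).1.derivWithin (uniqueDiffOn_Icc hb y hy)

theorem iteratedDerivWithin_eqOn (hb : 0 < b) (h : HasDerivPair b p q s) :
    EqOn (iteratedDerivWithin 2 p (Icc 0 b)) s (Icc 0 b) := by
  intro y hy
  rw [iteratedDerivWithin_succ, iteratedDerivWithin_one,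
    derivWithin_congr (h.derivWithin_eqOn hb) (h.derivWithin_eqOn hb hy)]
  exact (h y hy).2.derivWithin (uniqueDiffOn_Icc hb y hy)

theorem contDiffOn_right {n : ℕ} (hb : 0 < b) (h : HasDerivPair b p q s)
    (hs : ContDiffOn ℝ n s (Icc 0 b)) : ContDiffOn ℝ (n + 1) q (Icc 0 b) :=
  contDiffOn_succ_of_hasDerivWithinAt hb (fun y hy => (h y hy).2) hs

theorem contDiffOn_left {n : ℕ} (hb : 0 < b) (h : HasDerivPair b p q s)
    (hs : ContDiffOn ℝ n s (Icc 0 b)) : ContDiffOn ℝ (n + 2) p (Icc 0 b) := by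
  have h1 : ContDiffOn ℝ ((n + 1 : ℕ) : WithTop ℕ∞) q (Icc 0 b) := by
    exact_mod_cast h.contDiffOn_right hb hs
  have := contDiffOn_succ_of_hasDerivWithinAt hb (fun y hy => (h y hy).1) h1
  convert this using 1
  push_cast
  rw [add_assoc]
  norm_num

/-- A function with vanishing second derivative, value `0` at the left endpoint and slope `0` at
the right endpoint vanishes. -/
theorem eq_zero_of_mixed (hb : 0 < b) (h : HasDerivPair b p q s) (hs : ∀ y ∈ Icc 0 b, s y = 0)
    (hp : p 0 = 0) (hq : q b = 0) : ∀ y ∈ Icc 0 b, p y = 0 := by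
  have hu := uniqueDiffOn_Icc hb
  have hconst : ∀ y ∈ Icc 0 b, q y = q 0 := constant_of_derivWithin_zero
    (fun y hy => (h y hy).2.differentiableWithinAt)
    (fun y hy => by
      have hy' : y ∈ Icc 0 b := ⟨hy.1, hy.2.le⟩
      rw [(h y hy').2.derivWithin (hu y hy'), hs y hy'])
  have hq0 : ∀ y ∈ Icc 0 b, q y = 0 := fun y hy => by
    rw [hconst y hy, ← hconst b ⟨hb.le, le_rfl⟩, hq]
  intro y hy
  rw [← hp]
  exact constant_of_derivWithin_zero (fun y hy => (h y hy).1.differentiableWithinAt)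
    (fun y hy => by
      have hy' : y ∈ Icc 0 b := ⟨hy.1, hy.2.le⟩
      rw [(h y hy').1.derivWithin (hu y hy'), hq0 y hy']) y hy

end HasDerivPair

/-! ### Shooting solutions and steady states -/

/-- The right-hand side of the rescaled equation along `p`. -/
def reaction (ζ : ℝ → ℝ) (L : ℝ) (p : ℝ → ℝ) (y : ℝ) : ℝ :=
  L ^ 2 * (p y ^ 3 - p y + ζ (L * y))

section Shooting

variable {ζ : ℝ → ℝ} {c₀ L z : ℝ} {p q p' q' : ℝ → ℝ}

theorem continuousOn_comp_mul_Icc {b : ℝ} (hL : 0 < L) (hζ : ContinuousOn ζ (Ici 0)) :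
    ContinuousOn (fun y => ζ (L * y)) (Icc 0 b) :=
  hζ.comp (by fun_prop) fun _ hy => mul_nonneg hL.le hy.1

theorem continuousOn_reaction (hL : 0 < L) (hζ : ContinuousOn ζ (Ici 0))
    (hp : ContinuousOn p (Icc 0 1)) : ContinuousOn (reaction ζ L p) (Icc 0 1) :=
  continuousOn_const.mul (((hp.pow 3).sub hp).add (continuousOn_comp_mul_Icc hL hζ))

theorem IsShootingSolution.hasDerivPair (hL : 0 < L) (hζ : ContinuousOn ζ (Ici 0))
    (h : IsShootingSolution ζ c₀ L z p) :
    HasDerivPair 1 p (derivWithin p (Icc 0 1)) (reaction ζ L p) :=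
  h.contDiffOn.hasDerivPair_of_eqOn_Ioo one_pos
    (continuousOn_reaction hL hζ h.contDiffOn.continuousOn)
    fun y hy => by have := h.equation y hy; unfold reaction; linarith

theorem HasDerivPair.isShootingSolution (hL : 0 < L) (hζ : ContinuousOn ζ (Ici 0))
    (h : HasDerivPair 1 p q (reaction ζ L p)) (hp : p 0 = c₀) (hq : q 0 = z) :
    IsShootingSolution ζ c₀ L z p where
  contDiffOn := by
    have := h.contDiffOn_left (n := 0) one_pos
      (contDiffOn_zero.2 (continuousOn_reaction hL hζ h.continuousOn_left))
    simpa using this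
  equation y hy := by
    rw [h.iteratedDerivWithin_eqOn one_pos ⟨hy.1.le, hy.2.le⟩, reaction]
    ring
  initial_value := hp
  initial_slope := by rw [h.derivWithin_eqOn one_pos (by simp), hq]

/-- The difference of cubics has the factor `p - p'`; its cofactor is bounded on the compact
interval, which makes the difference satisfy a linear inequality. -/
theorem HasDerivPair.unique_reaction (h : HasDerivPair 1 p q (reaction ζ L p))
    (h' : HasDerivPair 1 p' q' (reaction ζ L p')) (hp : p 0 = p' 0) (hq : q 0 = q' 0) :
    ∀ y ∈ Icc (0 : ℝ) 1, p y = p' y ∧ q y = q' y := by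
  obtain ⟨K, hK⟩ := isCompact_Icc.exists_bound_of_continuousOn
    (f := fun y => L ^ 2 * (p y ^ 2 + p y * p' y + p' y ^ 2 - 1)) (s := Icc (0 : ℝ) 1)
    (continuousOn_const.mul ((((h.continuousOn_left.pow 2).add
      (h.continuousOn_left.mul h'.continuousOn_left)).add (h'.continuousOn_left.pow 2)).sub
      continuousOn_const))
  intro y hy
  have := (h.sub h').eq_zero (K := K) (fun y hy => by
    have e : reaction ζ L p y - reaction ζ L p' y =
        L ^ 2 * (p y ^ 2 + p y * p' y + p' y ^ 2 - 1) * (p y - p' y) := by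
      unfold reaction; ring
    rw [e, abs_mul]
    exact mul_le_mul_of_nonneg_right (hK y hy) (abs_nonneg _))
    (sub_eq_zero.2 hp) (sub_eq_zero.2 hq) y hy
  exact ⟨sub_eq_zero.1 this.1, sub_eq_zero.1 this.2⟩

/-- Uniqueness makes the chosen solution in `shootingMap` irrelevant. -/
theorem HasDerivPair.shootingMap_eq (hL : 0 < L) (hζ : ContinuousOn ζ (Ici 0))
    (h : HasDerivPair 1 p q (reaction ζ L p)) (hp : p 0 = c₀) (hq : q 0 = z) :
    shootingMap ζ c₀ L z = q 1 := by
  have hex : ∃ v, IsShootingSolution ζ c₀ L z v := ⟨p, h.isShootingSolution hL hζ hp hq⟩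
  rw [shootingMap, dif_pos hex]
  have hc := hex.choose_spec
  exact ((hc.hasDerivPair hL hζ).unique_reaction h (by rw [hc.initial_value, hp])
    (by rw [hc.initial_slope, hq]) 1 (by simp)).2

/-- The potential is `C²` and affine, with zero value on the left and zero slope on the right. -/
theorem IsSteadyState.chemPotential_eq_zero {u : ℝ → ℝ} (hL : 0 < L)
    (hζ : AnalyticOn ℝ ζ (Ici 0)) (h : IsSteadyState ζ c₀ L u) :
    ∀ x ∈ Icc 0 L, chemPotential ζ c₀ L u x = 0 := by
  have hu := uniqueDiffOn_Icc hL
  have hζ2 : ContDiffOn ℝ 2 ζ (Icc 0 L) :=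
    (hζ.contDiffOn (uniqueDiffOn_Ici 0)).mono Icc_subset_Ici_self
  have hu2 : ContDiffOn ℝ 2 u (Icc 0 L) := h.contDiffOn.of_le (by norm_num)
  have hd2 : ContDiffOn ℝ 2 (iteratedDerivWithin 2 u (Icc 0 L)) (Icc 0 L) := by
    have h1 : ContDiffOn ℝ 3 (derivWithin u (Icc 0 L)) (Icc 0 L) :=
      h.contDiffOn.derivWithin hu (by norm_num)
    have h2 : ContDiffOn ℝ 2 (derivWithin (derivWithin u (Icc 0 L)) (Icc 0 L)) (Icc 0 L) :=
      h1.derivWithin hu (by norm_num)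
    refine h2.congr fun x _ => ?_
    rw [iteratedDerivWithin_succ, iteratedDerivWithin_one]
  have hμ : ContDiffOn ℝ 2 (chemPotential ζ c₀ L u) (Icc 0 L) :=
    ((hd2.neg.add ((hu2.add contDiffOn_const).pow 3)).sub (hu2.add contDiffOn_const)).add hζ2
  exact (hμ.hasDerivPair_of_eqOn_Ioo hL (g := fun _ => 0) continuousOn_const
    h.equation).eq_zero_of_mixed hL (fun _ _ => rfl) h.potential_left h.potential_right

theorem IsSteadyState.hasDerivPair {u : ℝ → ℝ} (hL : 0 < L)
    (hζ : AnalyticOn ℝ ζ (Ici 0)) (h : IsSteadyState ζ c₀ L u) :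
    HasDerivPair 1 (fun y => u (L * y) + c₀) (fun y => L * derivWithin u (Icc 0 L) (L * y))
      (reaction ζ L (fun y => u (L * y) + c₀)) := by
  have hu2 : ContDiffOn ℝ 2 u (Icc 0 L) := h.contDiffOn.of_le (by norm_num)
  refine (((hu2.hasDerivPair hL).comp_mul hL (mul_one L)).add_const c₀).congr_right ?_
  intro y hy
  have := h.chemPotential_eq_zero hL hζ (L * y)
    ⟨mul_nonneg hL.le hy.1, by nlinarith [hy.2]⟩
  unfold chemPotential at this
  simp only [reaction]
  congr 1
  linarith

/-- Bootstrapping: smoothness of `ζ` lifts `u` from continuous to `C²` and then to `C⁴` through the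
equation. -/
theorem HasDerivPair.isSteadyState (hL : 0 < L) (hζ : AnalyticOn ℝ ζ (Ici 0))
    (h : HasDerivPair 1 p q (reaction ζ L p)) (hp : p 0 = c₀) (hq : q 1 = 0) :
    IsSteadyState ζ c₀ L (fun x => p (L⁻¹ * x) - c₀) := by
  set u : ℝ → ℝ := fun x => p (L⁻¹ * x) - c₀ with hudef
  have hζs : ∀ n : ℕ, ContDiffOn ℝ n ζ (Icc 0 L) := fun n =>
    (hζ.contDiffOn (uniqueDiffOn_Ici 0)).mono Icc_subset_Ici_self
  have hpair : HasDerivPair L u (fun x => L⁻¹ * q (L⁻¹ * x))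
      (fun x => (u x + c₀) ^ 3 - (u x + c₀) + ζ x) := by
    refine ((h.comp_mul (inv_pos.2 hL) (inv_mul_cancel₀ hL.ne')).sub_const c₀).congr_right ?_
    intro x _
    simp only [reaction, hudef, sub_add_cancel]
    rw [← mul_assoc, ← mul_pow, inv_mul_cancel₀ hL.ne', mul_inv_cancel_left₀ hL.ne']
    ring
  have hrhs : ∀ n : ℕ, ContDiffOn ℝ n u (Icc 0 L) →
      ContDiffOn ℝ n (fun x => (u x + c₀) ^ 3 - (u x + c₀) + ζ x) (Icc 0 L) := fun n hn =>
    (((hn.add contDiffOn_const).pow 3).sub (hn.add contDiffOn_const)).add (hζs n)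
  have hu2 : ContDiffOn ℝ 2 u (Icc 0 L) := by
    simpa using hpair.contDiffOn_left (n := 0) hL
      (hrhs 0 (contDiffOn_zero.2 hpair.continuousOn_left))
  have hu4 : ContDiffOn ℝ 4 u (Icc 0 L) := by
    have := hpair.contDiffOn_left (n := 2) hL (hrhs 2 hu2)
    convert this using 1
    norm_num
  have hμ : EqOn (chemPotential ζ c₀ L u) (fun _ => 0) (Icc 0 L) := fun x hx => by
    simp only [chemPotential]
    rw [hpair.iteratedDerivWithin_eqOn hL hx]
    ring
  have hL' : L ∈ Icc 0 L := ⟨hL.le, le_rfl⟩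
  refine ⟨hu4, fun x hx => ?_, by simp [hudef, hp], ?_, hμ ⟨le_rfl, hL.le⟩, ?_⟩
  · rw [iteratedDerivWithin_congr hμ ⟨hx.1.le, hx.2.le⟩]
    simp
  · rw [hpair.derivWithin_eqOn hL hL']
    simp [hL.ne', hq]
  · rw [derivWithin_congr hμ (hμ hL')]
    simp

/-- The range condition concerns positive arguments only; continuity carries its closed form to `0`.
-/
theorem abs_le_one_of_mem_Ioo (hζ : ContinuousOn ζ (Ici 0))
    (hr : ∀ x, 0 < x → ζ x ∈ Ioo (-1 : ℝ) 0) : ∀ x, 0 ≤ x → |ζ x| ≤ 1 := by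
  have hmaps : MapsTo ζ (closure (Ioi 0)) (closure (Icc (-1) 0)) :=
    MapsTo.closure_of_continuousOn (fun x hx => Ioo_subset_Icc_self (hr x hx))
      (by rwa [closure_Ioi])
  rw [closure_Ioi, isClosed_Icc.closure_eq] at hmaps
  intro x hx
  have := hmaps hx
  exact abs_le.2 ⟨this.1, this.2.trans zero_le_one⟩

/-! ### The clamped flow and a priori bounds -/

/-- The right-hand side of the rescaled equation with the unknown clamped to `[-3, 3]`. -/
noncomputable def clampedReaction (ζ : ℝ → ℝ) (L y x : ℝ) : ℝ :=
  L ^ 2 * (clamp 3 x ^ 3 - clamp 3 x + ζ (L * y))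

theorem clampedReaction_of_abs_le {y : ℝ} (h : |p y| ≤ 3) :
    clampedReaction ζ L y (p y) = reaction ζ L p y := by
  rw [clampedReaction, reaction, clamp_of_abs_le h]

theorem abs_clampedReaction_sub_le (L y x x' : ℝ) :
    |clampedReaction ζ L y x - clampedReaction ζ L y x'| ≤ L ^ 2 * 28 * |x - x'| := by
  set c := clamp 3 x with hc
  set d := clamp 3 x' with hd
  have hc' : |c| ≤ 3 := abs_clamp_le (by norm_num) x
  have hd' : |d| ≤ 3 := abs_clamp_le (by norm_num) x'
  have e : clampedReaction ζ L y x - clampedReaction ζ L y x' =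
      L ^ 2 * ((c ^ 2 + c * d + d ^ 2 - 1) * (c - d)) := by
    unfold clampedReaction; ring
  rw [e, abs_mul, abs_mul, abs_of_nonneg (sq_nonneg L), mul_assoc]
  refine mul_le_mul_of_nonneg_left (mul_le_mul ?_ (abs_clamp_sub_le _ _ _) (abs_nonneg _)
    (by norm_num)) (sq_nonneg L)
  rw [abs_le] at *
  constructor <;> nlinarith [sq_nonneg (c + d), sq_nonneg (c - d)]

theorem abs_clampedReaction_le (hL : 0 < L) (hb : ∀ x, 0 ≤ x → |ζ x| ≤ 1) {y : ℝ} (hy : 0 ≤ y)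
    (x : ℝ) : |clampedReaction ζ L y x| ≤ L ^ 2 * 31 := by
  have hc := abs_clamp_le (R := 3) (by norm_num) x
  have hz := hb (L * y) (mul_nonneg hL.le hy)
  rw [clampedReaction, abs_mul, abs_of_nonneg (sq_nonneg L)]
  refine mul_le_mul_of_nonneg_left ?_ (sq_nonneg L)
  set c := clamp 3 x
  have h1 : |c ^ 3 - c| ≤ 30 := by
    calc |c ^ 3 - c| ≤ |c ^ 3| + |c| := abs_sub _ _
      _ = |c| ^ 3 + |c| := by rw [abs_pow]
      _ ≤ 3 ^ 3 + 3 := by gcongr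
      _ = 30 := by norm_num
  exact (abs_add_le _ _).trans (by linarith)

theorem exists_clamped_flow (hL : 0 < L) (hζ : ContinuousOn ζ (Ici 0))
    (hb : ∀ x, 0 ≤ x → |ζ x| ≤ 1) (c₀ : ℝ) :
    ∃ P Q : ℝ → ℝ → ℝ, ∀ z, P z 0 = c₀ ∧ Q z 0 = z ∧
      HasDerivPair 1 (P z) (Q z) (fun y => clampedReaction ζ L y (P z y)) := by
  have key := exists_hasDerivPair (G := clampedReaction ζ L)
    (C := ⟨L ^ 2 * 31, by positivity⟩) (K := ⟨L ^ 2 * 28, by positivity⟩)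
    (fun y _ => LipschitzWith.of_dist_le_mul fun x x' => abs_clampedReaction_sub_le L y x x')
    (fun x => continuousOn_const.mul (continuousOn_const.add (continuousOn_comp_mul_Icc hL hζ)))
    (fun y hy x => abs_clampedReaction_le hL hb hy.1 x) c₀
  choose P Q h using key
  exact ⟨P, Q, h⟩

/-- Solutions of the boundary value problem with a coercive right-hand side take values in
`[-2, 2]`. -/
theorem HasDerivPair.abs_le_two {s : ℝ → ℝ} (h : HasDerivPair 1 p q s)
    (hc₀ : c₀ ∈ Ioo (-1 : ℝ) 0) (hp : p 0 = c₀) (hq : q 1 = 0)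
    (hpos : ∀ y ∈ Ioc (0 : ℝ) 1, 2 < p y → 0 < s y)
    (hneg : ∀ y ∈ Ioc (0 : ℝ) 1, p y < -2 → s y < 0) : ∀ y ∈ Icc (0 : ℝ) 1, |p y| ≤ 2 := by
  intro y hy
  rw [abs_le]
  refine ⟨?_, h.le_of_convex zero_le_one (by linarith [hc₀.2]) hq hpos y hy⟩
  have := h.neg.le_of_convex (M := 2) zero_le_one (by linarith [hc₀.1]) (by simp [hq])
    (fun y hy h2 => neg_pos.2 (hneg y hy (by linarith))) y hy
  linarith

theorem HasDerivPair.abs_le_two_of_reaction (hL : 0 < L)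
    (hr : ∀ x, 0 < x → ζ x ∈ Ioo (-1 : ℝ) 0) (hc₀ : c₀ ∈ Ioo (-1 : ℝ) 0)
    (h : HasDerivPair 1 p q (reaction ζ L p)) (hp : p 0 = c₀) (hq : q 1 = 0) :
    ∀ y ∈ Icc (0 : ℝ) 1, |p y| ≤ 2 := by
  refine h.abs_le_two hc₀ hp hq (fun y hy h2 => ?_) (fun y hy h2 => ?_)
  · refine mul_pos (by positivity) ?_
    nlinarith [(hr (L * y) (mul_pos hL hy.1)).1, mul_pos (sub_pos.2 h2) (sub_pos.2 h2),
      mul_pos (sub_pos.2 h2) (mul_pos (sub_pos.2 h2) (sub_pos.2 h2))]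
  · refine mul_neg_of_pos_of_neg (by positivity) ?_
    have h3 : 0 < -2 - p y := by linarith
    nlinarith [(hr (L * y) (mul_pos hL hy.1)).2, mul_pos h3 h3, mul_pos h3 (mul_pos h3 h3)]

/-- The clamp level `3` exceeds `2`, so clamping preserves `v > 2` and `v < -2`, where `v³ - v`
dominates `ζ` and fixes the sign of the field. -/
theorem HasDerivPair.abs_le_two_of_clampedReaction (hL : 0 < L)
    (hr : ∀ x, 0 < x → ζ x ∈ Ioo (-1 : ℝ) 0) (hc₀ : c₀ ∈ Ioo (-1 : ℝ) 0)
    (h : HasDerivPair 1 p q (fun y => clampedReaction ζ L y (p y))) (hp : p 0 = c₀)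
    (hq : q 1 = 0) : ∀ y ∈ Icc (0 : ℝ) 1, |p y| ≤ 2 := by
  refine h.abs_le_two hc₀ hp hq (fun y hy h2 => ?_) (fun y hy h2 => ?_)
  · refine mul_pos (by positivity) ?_
    have h2 : 2 < clamp 3 (p y) := lt_max_of_lt_right (lt_min h2 (by norm_num))
    nlinarith [(hr (L * y) (mul_pos hL hy.1)).1, mul_pos (sub_pos.2 h2) (sub_pos.2 h2),
      mul_pos (sub_pos.2 h2) (mul_pos (sub_pos.2 h2) (sub_pos.2 h2))]
  · refine mul_neg_of_pos_of_neg (by positivity) ?_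
    have h3 : clamp 3 (p y) < -2 := max_lt (by norm_num) (min_lt_of_left_lt h2)
    have h3 : 0 < -2 - clamp 3 (p y) := by linarith
    nlinarith [(hr (L * y) (mul_pos hL hy.1)).2, mul_pos h3 h3, mul_pos h3 (mul_pos h3 h3)]

/-! ### Dependence on the initial slope -/

section Flow

variable {P Q : ℝ → ℝ → ℝ}

theorem exists_flow_lipschitz
    (hflow : ∀ z, P z 0 = c₀ ∧ Q z 0 = z ∧
      HasDerivPair 1 (P z) (Q z) (fun y => clampedReaction ζ L y (P z y))) :
    ∃ M : ℝ, 0 < M ∧ ∀ w z, ∀ y ∈ Icc (0 : ℝ) 1,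
      |P w y - P z y| ≤ |w - z| * M ∧ |Q w y - Q z y| ≤ |w - z| * M := by
  refine ⟨Real.exp ((L ^ 2 * 28 + 1) * 1), Real.exp_pos _, fun w z => ?_⟩
  obtain ⟨hw0, hw1, hw⟩ := hflow w
  obtain ⟨hz0, hz1, hz⟩ := hflow z
  have := (hw.sub hz).abs_le_exp (K := L ^ 2 * 28 + 1) (ε := 0) (δ := |w - z|)
    (by nlinarith [sq_nonneg L]) le_rfl
    (fun y _ => by
      have := abs_clampedReaction_sub_le (ζ := ζ) L y (P w y) (P z y)
      nlinarith [abs_nonneg (P w y - P z y)])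
    (by simp [hw0, hz0]) (by rw [hw1, hz1])
  simpa using this

/-- The shooting function is differentiable at its zeros; the derivative is the terminal slope of
the solution of the linearized equation. -/
theorem hasDerivAt_flow
    (hflow : ∀ z, P z 0 = c₀ ∧ Q z 0 = z ∧
      HasDerivPair 1 (P z) (Q z) (fun y => clampedReaction ζ L y (P z y)))
    (hz : ∀ y ∈ Icc (0 : ℝ) 1, |P z y| ≤ 2) {h k : ℝ → ℝ} (h0 : h 0 = 0) (k0 : k 0 = 1)
    (hk : HasDerivPair 1 h k (fun y => L ^ 2 * (3 * P z y ^ 2 - 1) * h y)) :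
    (∀ᶠ w in 𝓝 z, ∀ y ∈ Icc (0 : ℝ) 1, |P w y| ≤ 3) ∧
      HasDerivAt (fun w => Q w 1) (k 1) z := by
  obtain ⟨M, hM, hlip⟩ := exists_flow_lipschitz hflow
  have hclose : ∀ᶠ w in 𝓝 z, ∀ y ∈ Icc (0 : ℝ) 1, |P w y - P z y| ≤ 1 := by
    filter_upwards [Metric.ball_mem_nhds z (inv_pos.2 hM)] with w hw y hy
    refine (hlip w z y hy).1.trans ?_
    rw [Metric.mem_ball, Real.dist_eq] at hw
    calc |w - z| * M ≤ M⁻¹ * M := mul_le_mul_of_nonneg_right hw.le hM.le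
      _ = 1 := inv_mul_cancel₀ hM.ne'
  have hthree : ∀ w, (∀ y ∈ Icc (0 : ℝ) 1, |P w y - P z y| ≤ 1) →
      ∀ y ∈ Icc (0 : ℝ) 1, |P w y| ≤ 3 := fun w hw y hy => by
    have h1 := hw y hy
    have h2 := hz y hy
    rw [abs_le] at *
    constructor <;> linarith
  refine ⟨hclose.mono hthree, ?_⟩
  rw [hasDerivAt_iff_isLittleO]
  set C : ℝ := L ^ 2 * (7 * M ^ 2) * Real.exp ((L ^ 2 * 11 + 1) * 1) with hC
  refine Asymptotics.IsBigO.trans_isLittleO (g := fun w => ‖w - z‖ ^ 2) ?_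
    (Asymptotics.isLittleO_pow_sub_sub z one_lt_two)
  refine Asymptotics.IsBigO.of_bound C ?_
  filter_upwards [hclose] with w hw
  have hw3 := hthree w hw
  obtain ⟨hw0, hw1, hwp⟩ := hflow w
  obtain ⟨hz0, hz1, hzp⟩ := hflow z
  -- The first order Taylor remainder has zero initial data. It solves the linearized equation up to
  -- `L² (3P + d) d²`, which is quadratic in `w - z`; Gronwall keeps it so.
  have hrem := ((hwp.sub hzp).sub (hk.const_mul (w - z))).abs_le_exp (K := L ^ 2 * 11 + 1)
    (ε := L ^ 2 * (7 * M ^ 2) * |w - z| ^ 2) (δ := 0)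
    (by nlinarith [sq_nonneg L]) (by positivity)
    (fun y hy => by
      rw [clampedReaction_of_abs_le (hw3 y hy),
        clampedReaction_of_abs_le ((hz y hy).trans (by norm_num))]
      set d := P w y - P z y with hd
      have e : reaction ζ L (P w) y - reaction ζ L (P z) y
          - (w - z) * (L ^ 2 * (3 * P z y ^ 2 - 1) * h y)
          = L ^ 2 * ((3 * P z y ^ 2 - 1) * (d - (w - z) * h y))
            + L ^ 2 * ((3 * P z y + d) * d ^ 2) := by
        rw [hd]; unfold reaction; ring
      have hP := abs_le.1 (hz y hy)
      have hd1 := abs_le.1 (hw y hy)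
      have h1 : |3 * P z y ^ 2 - 1| ≤ 11 := by
        rw [abs_le]; constructor <;> nlinarith
      have h2 : |3 * P z y + d| ≤ 7 := by
        rw [abs_le]; constructor <;> linarith
      have h3 : d ^ 2 ≤ M ^ 2 * |w - z| ^ 2 := by
        rw [← sq_abs d, ← mul_pow, mul_comm M]
        exact pow_le_pow_left₀ (abs_nonneg _) (hlip w z y hy).1 2
      rw [e]
      refine (abs_add_le _ _).trans (add_le_add ?_ ?_)
      · rw [abs_mul, abs_mul, abs_of_nonneg (sq_nonneg L), ← mul_assoc]
        refine mul_le_mul_of_nonneg_right ?_ (abs_nonneg _)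
        nlinarith [mul_le_mul_of_nonneg_left h1 (sq_nonneg L)]
      · rw [abs_mul, abs_mul, abs_of_nonneg (sq_nonneg L), abs_of_nonneg (sq_nonneg d), mul_assoc,
          mul_assoc 7]
        exact mul_le_mul_of_nonneg_left (mul_le_mul h2 h3 (sq_nonneg _) (by norm_num))
          (sq_nonneg L))
    (by simp [hw0, hz0, h0]) (by simp [hw1, hz1, k0])
  have := (hrem 1 (by simp)).2
  rw [Real.norm_eq_abs, Real.norm_eq_abs, Real.norm_eq_abs, abs_of_nonneg (sq_nonneg |w - z|),
    smul_eq_mul]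
  refine this.trans (le_of_eq ?_)
  rw [hC]
  ring

end Flow

/-! ### The kernel of the linearized operator -/

theorem hasDerivWithinAt_primitive {b : ℝ} {f g : ℝ → ℝ} (hg : ContinuousOn g (Icc 0 b))
    (hf : ∀ x ∈ Icc 0 b, f x = f 0 + ∫ s in (0 : ℝ)..x, g s) :
    ∀ x ∈ Icc 0 b, HasDerivWithinAt f (g x) (Icc 0 b) x := by
  intro x hx
  have : Fact (x ∈ Icc 0 b) := ⟨hx⟩
  have hint : IntervalIntegrable g MeasureTheory.volume 0 x :=
    (hg.mono (Icc_subset_Icc_right hx.2)).intervalIntegrable_of_Icc hx.1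
  have := intervalIntegral.integral_hasDerivWithinAt_right hint (s := Icc 0 b) (t := Icc 0 b)
    (hg.stronglyMeasurableAtFilter_nhdsWithin measurableSet_Icc x) (hg x hx)
  exact (this.const_add (f 0)).congr hf (hf x hx)

/-- Weak solutions are classical: replacing `h₂` by the continuous `g` changes no integral. -/
theorem IsH2With.hasDerivPair {h h₁ h₂ g : ℝ → ℝ} (hL : 0 < L) (hh : IsH2With L h h₁ h₂)
    (hg : ContinuousOn h (Icc 0 L) → ContinuousOn g (Icc 0 L))
    (hae : ∀ᵐ x ∂(MeasureTheory.volume.restrict (Ioo 0 L)), h₂ x = g x) :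
    HasDerivPair L h h₁ g := by
  have hint : MeasureTheory.IntegrableOn h₂ (uIcc 0 L) := by
    rw [uIcc_of_le hL.le, integrableOn_Icc_iff_integrableOn_Ioo]
    exact hh.memLp.integrable (by norm_num)
  have hc₁ : ContinuousOn h₁ (Icc 0 L) := by
    have := intervalIntegral.continuousOn_primitive_interval hint
    rw [uIcc_of_le hL.le] at this
    exact (continuousOn_const.add this).congr hh.deriv_eq
  have hd := hasDerivWithinAt_primitive hc₁ hh.eq
  have hgc := hg fun x hx => (hd x hx).continuousWithinAt
  refine fun x hx => ⟨hd x hx, hasDerivWithinAt_primitive hgc (fun y hy => ?_) x hx⟩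
  rw [hh.deriv_eq y hy]
  congr 1
  refine intervalIntegral.integral_congr_ae_restrict ?_
  rw [uIoc_of_le hy.1]
  have h1 : MeasureTheory.volume.restrict (Ioc 0 y) ≤ MeasureTheory.volume.restrict (Ioc 0 L) :=
    MeasureTheory.Measure.restrict_mono (Ioc_subset_Ioc_right hy.2) le_rfl
  rw [← MeasureTheory.restrict_Ioo_eq_restrict_Ioc] at h1
  rw [← MeasureTheory.restrict_Ioo_eq_restrict_Ioc]
  refine MeasureTheory.ae_mono ?_ hae
  exact MeasureTheory.Measure.restrict_mono (Ioo_subset_Ioo_right hy.2) le_rfl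

/-- If the solution of the linearized initial value problem has nonzero terminal slope, the
linearized operator has trivial kernel. -/
theorem InLinearizedKernel.eq_zero {u h P H K : ℝ → ℝ} (hL : 0 < L)
    (hker : InLinearizedKernel c₀ L u h) (hu : ContinuousOn u (Icc 0 L))
    (huP : ∀ y ∈ Icc (0 : ℝ) 1, u (L * y) + c₀ = P y) (hP : ContinuousOn P (Icc 0 1))
    (hH : H 0 = 0) (hK : K 0 = 1) (hK1 : K 1 ≠ 0)
    (hlin : HasDerivPair 1 H K (fun y => L ^ 2 * (3 * P y ^ 2 - 1) * H y)) :
    ∀ x ∈ Icc 0 L, h x = 0 := by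
  obtain ⟨h₁, h₂, hh, h0, h1, hae⟩ := hker
  have hpair := hh.hasDerivPair hL (g := fun x => (3 * (u x + c₀) ^ 2 - 1) * h x)
    (fun hc => ((continuousOn_const.mul ((hu.add continuousOn_const).pow 2)).sub
      continuousOn_const).mul hc)
    (hae.mono fun x hx => by linarith)
  have hres := (hpair.comp_mul hL (mul_one L)).congr_right
    (s' := fun y => L ^ 2 * (3 * P y ^ 2 - 1) * h (L * y))
    (fun y hy => by simp only [huP y hy]; ring)
  obtain ⟨A, hA⟩ := isCompact_Icc.exists_bound_of_continuousOn
    (f := fun y => L ^ 2 * (3 * P y ^ 2 - 1)) (s := Icc (0 : ℝ) 1)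
    (continuousOn_const.mul ((continuousOn_const.mul (hP.pow 2)).sub continuousOn_const))
  -- Uniqueness: the rescaled `h` has initial data `(0, L * h₁ 0)`, hence equals `L * h₁ 0` times
  -- `H`.
  have hzero := (hres.sub (hlin.const_mul (L * h₁ 0))).eq_zero (K := A)
    (fun y hy => by
      have e : L ^ 2 * (3 * P y ^ 2 - 1) * h (L * y)
          - L * h₁ 0 * (L ^ 2 * (3 * P y ^ 2 - 1) * H y)
          = L ^ 2 * (3 * P y ^ 2 - 1) * (h (L * y) - L * h₁ 0 * H y) := by ring
      rw [e, abs_mul]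
      exact mul_le_mul_of_nonneg_right (hA y hy) (abs_nonneg _))
    (by simp [h0, hH]) (by simp [hK])
  have hα : L * h₁ 0 = 0 := by
    have := (hzero 1 (by simp)).2
    simp only [mul_one, h1, mul_zero, zero_sub, neg_eq_zero, mul_eq_zero, hK1, or_false] at this
    simpa using this
  intro x hx
  have := (hzero (x / L) ⟨div_nonneg hx.1 hL.le, (div_le_one hL).2 hx.2⟩).1
  rw [hα, mul_div_cancel₀ _ hL.ne'] at this
  simpa using this

end Shooting

/-! ### Finiteness and nondegeneracy -/

theorem mainTheorem6 (ζ : ℝ → ℝ) (hζ : AnalyticOn ℝ ζ (Set.Ici 0))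
    (hζ_range : ∀ x, 0 < x → ζ x ∈ Set.Ioo (-1 : ℝ) 0)
    (c₀ : ℝ) (hc₀ : c₀ ∈ Set.Ioo (-1 : ℝ) 0)
    (L : ℝ) (hL : L ∈ Set.Ioi (0 : ℝ) \ exceptionalLengths ζ c₀) :
    ∃ (N : ℕ) (u : Fin N → ℝ → ℝ), 0 < N ∧
      (∀ i, IsSteadyState ζ c₀ L (u i)) ∧
      (∀ i j, Set.EqOn (u i) (u j) (Set.Icc 0 L) → i = j) ∧
      (∀ w, IsSteadyState ζ c₀ L w → ∃ i, Set.EqOn w (u i) (Set.Icc 0 L)) ∧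
      (∀ i h, InLinearizedKernel c₀ L (u i) h → ∀ x ∈ Set.Icc 0 L, h x = 0) := by
  obtain ⟨hL0, hE⟩ := hL
  replace hL0 : 0 < L := hL0
  have hc : ContinuousOn ζ (Ici 0) := hζ.continuousOn
  have hb := abs_le_one_of_mem_Ioo hc hζ_range
  obtain ⟨P, Q, hflow⟩ := exists_clamped_flow hL0 hc hb c₀
  set Z : Set ℝ := {z | Q z 1 = 0} with hZ
  have hbound : ∀ z ∈ Z, ∀ y ∈ Icc (0 : ℝ) 1, |P z y| ≤ 2 := fun z hz =>
    (hflow z).2.2.abs_le_two_of_clampedReaction hL0 hζ_range hc₀ (hflow z).1 hz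
  have hreact : ∀ z, (∀ y ∈ Icc (0 : ℝ) 1, |P z y| ≤ 3) →
      HasDerivPair 1 (P z) (Q z) (reaction ζ L (P z)) := fun z hz =>
    (hflow z).2.2.congr_right fun y hy => clampedReaction_of_abs_le (hz y hy)
  have hreactZ : ∀ z ∈ Z, HasDerivPair 1 (P z) (Q z) (reaction ζ L (P z)) := fun z hz =>
    hreact z fun y hy => (hbound z hz y hy).trans (by norm_num)
  have hcont : Continuous fun z => Q z 1 := by
    obtain ⟨M, hM, hlip⟩ := exists_flow_lipschitz hflow
    refine (LipschitzWith.of_dist_le_mul (K := ⟨M, hM.le⟩) fun w z => ?_).continuous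
    rw [Real.dist_eq, Real.dist_eq, mul_comm]
    exact (hlip w z 1 (by simp)).2
  have hnear : ∀ z, |Q z 1 - z| ≤ L ^ 2 * 31 := fun z => by
    obtain ⟨-, hq, hpair⟩ := hflow z
    have := (convex_Icc (0 : ℝ) 1).norm_image_sub_le_of_norm_hasDerivWithin_le
      (fun y hy => (hpair y hy).2) (fun y hy => abs_clampedReaction_le hL0 hb hy.1 _)
      (left_mem_Icc.2 zero_le_one) (right_mem_Icc.2 zero_le_one)
    simpa [hq] using this
  have hne : Z.Nonempty := by
    have h1 := abs_le.1 (hnear (-(L ^ 2 * 31)))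
    have h2 := abs_le.1 (hnear (L ^ 2 * 31))
    exact mem_range_of_exists_le_of_exists_ge hcont
      ⟨-(L ^ 2 * 31), by linarith⟩ ⟨L ^ 2 * 31, by linarith⟩
  have hlin : ∀ z ∈ Z, ∃ H K : ℝ → ℝ, H 0 = 0 ∧ K 0 = 1 ∧ K 1 ≠ 0 ∧
      HasDerivPair 1 H K (fun y => L ^ 2 * (3 * P z y ^ 2 - 1) * H y) ∧
      HasDerivAt (fun w => Q w 1) (K 1) z := fun z hz => by
    obtain ⟨H, K, hH, hK, hpair⟩ := exists_hasDerivPair_linear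
      (a := fun y => L ^ 2 * (3 * P z y ^ 2 - 1)) (continuousOn_const.mul
        ((continuousOn_const.mul ((hflow z).2.2.continuousOn_left.pow 2)).sub continuousOn_const))
    obtain ⟨hev, hder⟩ := hasDerivAt_flow hflow (hbound z hz) hH hK hpair
    -- If `K 1 = 0`, then `z` is a branch point: `shootingMap` agrees with `Q · 1` near `z`, so its
    -- derivative there is `0`.
    refine ⟨H, K, hH, hK, fun h0 => hE ⟨hL0, z, ⟨⟨P z, ?_⟩, ?_⟩, ?_⟩, hpair, hder⟩
    · exact (hreactZ z hz).isShootingSolution hL0 hc (hflow z).1 (hflow z).2.1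
    · rw [(hreactZ z hz).shootingMap_eq hL0 hc (hflow z).1 (hflow z).2.1]
      exact hz
    · rw [h0] at hder
      exact hder.congr_of_eventuallyEq (hev.mono fun w hw =>
        (hreact w hw).shootingMap_eq hL0 hc (hflow w).1 (hflow w).2.1)
  have hcompact : IsCompact Z := by
    refine Metric.isCompact_of_isClosed_isBounded (isClosed_eq hcont continuous_const) ?_
    refine (Metric.isBounded_Icc (-(L ^ 2 * 31)) (L ^ 2 * 31)).subset fun z hz => ?_
    have := hnear z
    rw [show Q z 1 = 0 from hz, zero_sub, abs_neg] at this
    exact abs_le.1 this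
  have hfin : Z.Finite := by
    by_contra hinf
    obtain ⟨z, hz, hacc⟩ := Set.Infinite.exists_accPt_of_subset_isCompact hinf hcompact Subset.rfl
    obtain ⟨H, K, -, -, hK1, -, hder⟩ := hlin z hz
    -- A nonzero derivative excludes other zeros near `z`, so `z` cannot be an accumulation point of
    -- `Z`.
    obtain ⟨w, hw, hwZ⟩ := ((accPt_iff_frequently_nhdsNE.1 hacc).and_eventually
      (hder.eventually_ne (c := 0) hK1)).exists
    exact hwZ hw
  have := hfin.to_subtype
  have := hne.to_subtype
  obtain ⟨N, ⟨e⟩⟩ := Finite.exists_equiv_fin Z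
  have hmul : ∀ y ∈ Icc (0 : ℝ) 1, L * y ∈ Icc 0 L := fun y hy =>
    ⟨mul_nonneg hL0.le hy.1, mul_le_of_le_one_right hL0.le hy.2⟩
  set u : Z → ℝ → ℝ := fun z x => P z (L⁻¹ * x) - c₀ with hu
  have huP : ∀ z y, u z (L * y) + c₀ = P z y := fun z y => by
    simp only [hu, inv_mul_cancel_left₀ hL0.ne', sub_add_cancel]
  have hsteady : ∀ z, IsSteadyState ζ c₀ L (u z) := fun z =>
    (hreactZ z z.2).isSteadyState hL0 hζ (hflow z).1 z.2
  refine ⟨N, fun i => u (e.symm i), ?_, fun i => hsteady _, fun i j hij => ?_, fun w hw => ?_,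
    fun i h hker => ?_⟩
  · obtain ⟨z⟩ := ‹Nonempty Z›
    exact (Nat.zero_le _).trans_lt (e z).2
  · refine e.symm.injective (Subtype.ext ?_)
    have heq : EqOn (P (e.symm i)) (P (e.symm j)) (Icc 0 1) := fun y hy => by
      have := hij (hmul y hy)
      simp only at this
      rw [← huP, ← huP, this]
    have h0 : (0 : ℝ) ∈ Icc (0 : ℝ) 1 := by simp
    -- The parameter is recovered from the trajectory as its slope at `0`.
    rw [← (hflow (e.symm i)).2.1, ← (hflow (e.symm j)).2.1,
      ← (hflow (e.symm i)).2.2.derivWithin_eqOn one_pos h0,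
      ← (hflow (e.symm j)).2.2.derivWithin_eqOn one_pos h0, derivWithin_congr heq (heq h0)]
  · have hwp := hw.hasDerivPair hL0 hζ
    have hw1 : L * derivWithin w (Icc 0 L) (L * 1) = 0 := by
      rw [mul_one, hw.neumann_right, mul_zero]
    have hw0 : w (L * 0) + c₀ = c₀ := by rw [mul_zero, hw.dirichlet_left, zero_add]
    have hw2 := hwp.abs_le_two_of_reaction hL0 hζ_range hc₀ hw0 hw1
    set z := L * derivWithin w (Icc 0 L) (L * 0) with hzdef
    -- The a priori bound turns an arbitrary steady state into a clamped trajectory, to be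
    -- identified with `P z` by uniqueness.
    have hwc := hwp.congr_right (s' := fun y => clampedReaction ζ L y (w (L * y) + c₀))
      fun y hy => (clampedReaction_of_abs_le (p := fun y => w (L * y) + c₀)
        ((hw2 y hy).trans (by norm_num))).symm
    have huniq : ∀ y ∈ Icc (0 : ℝ) 1, w (L * y) + c₀ = P z y ∧
        L * derivWithin w (Icc 0 L) (L * y) = Q z y := fun y hy => by
      have := (hwc.sub (hflow z).2.2).eq_zero
        (fun y _ => abs_clampedReaction_sub_le L y _ _)
        (by rw [hw0, (hflow z).1, sub_self]) (by rw [(hflow z).2.1, hzdef, sub_self]) y hy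
      exact ⟨sub_eq_zero.1 this.1, sub_eq_zero.1 this.2⟩
    have hzZ : z ∈ Z := by
      exact (huniq 1 (by simp)).2.symm.trans hw1
    refine ⟨e ⟨z, hzZ⟩, fun x hx => ?_⟩
    have := (huniq (L⁻¹ * x) ⟨mul_nonneg (inv_nonneg.2 hL0.le) hx.1, by
      rw [inv_mul_le_iff₀ hL0, mul_one]; exact hx.2⟩).1
    rw [mul_inv_cancel_left₀ hL0.ne'] at this
    simp only [Equiv.symm_apply_apply, hu]
    rw [← this, add_sub_cancel_right]
  · obtain ⟨H, K, hH, hK, hK1, hpair, -⟩ := hlin _ (e.symm i).2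
    exact hker.eq_zero hL0 (hsteady _).contDiffOn.continuousOn (fun y _ => huP _ y)
      (hflow (e.symm i)).2.2.continuousOn_left hH hK hK1 hpair
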